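/- All matroids are finite. For positive integers $k,\ell$, a matroid is called $(k,\ell)$-uniform if it has no minor isomorphic to $U_{k,k}\oplus U_{0,\ell}$, the direct sum of the free matroid on $k$ elements and the matroid consisting of $\ell$ loops. For every pair $(k,\ell)$ of positive integers and every prime power $q$, there is a constant $c$, depending only on $k$, $\ell$ and $q$, such that every simple cosimple $GF(q)$-representable $(k,\ell)$-uniform matroid $M$ satisfies $r(M)\le c$. Let $f(k,\ell,q)$ denote the least such non-negative integer $c$. Then, whenever $k\ge 2$, $$f(k,\ell,q)\le\max\{f(k-1,\ell+1,q),\ f(1,\ell,q)+(k-1)\}.$$ -/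

import Mathlib

open Set

universe u

namespace Matroid

/-- Matroid isomorphism: a bijection between the ground sets that preserves independence in both
directions. -/
def IsIsomorphic {α β : Type*} (M : Matroid α) (N : Matroid β) : Prop :=
  ∃ e : M.E ≃ N.E, ∀ I : Set M.E,
    M.Indep ((↑) '' I : Set α) ↔ N.Indep ((↑) '' (e '' I) : Set β)

/-- The matroid `U_{k,k} ⊕ U_{0,ℓ}`: the direct sum of the matroid on `k` elements in which every
set is independent and the matroid on `ℓ` elements in which every element is a loop. -/
def freeSumLoopy (k l : ℕ) : Matroid (Fin k ⊕ Fin l) :=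
  (freeOn (univ : Set (Fin k))).sum (loopyOn (univ : Set (Fin l)))

/-- `M` is `(k, ℓ)`-uniform if no minor of `M` is isomorphic to `U_{k,k} ⊕ U_{0,ℓ}`. -/
def IsKLUniform {α : Type*} (M : Matroid α) (k l : ℕ) : Prop :=
  ∀ N : Matroid α, N ≤m M → ¬ N.IsIsomorphic (freeSumLoopy k l)

/-- `M` is simple: it has no loops and no parallel pairs (two-element circuits). -/
def IsSimple {α : Type*} (M : Matroid α) : Prop :=
  (∀ e, ¬ M.IsLoop e) ∧ ∀ e f, e ≠ f → ¬ M.IsCircuit {e, f}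

/-- `M` is cosimple: its dual is simple. -/
def IsCosimple {α : Type*} (M : Matroid α) : Prop := M✶.IsSimple

/-- `M` is representable over the field `F`: for some matrix over `F` whose columns are labelled by
the elements, a set of elements is independent exactly when the corresponding columns are linearly
independent. (Columns with labels outside the ground set play no role.) -/
def IsRepresentableOver {α : Type*} (M : Matroid α) (F : Type*) [Field F] : Prop :=
  ∃ (m : ℕ) (A : Matrix (Fin m) α F),
    ∀ I : Set α, I ⊆ M.E → (M.Indep I ↔ LinearIndepOn F (fun j => A.col j) I)

/-- `M` is `GF(q)`-representable: it is representable over a field with `q` elements. (For a prime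
power `q`, such a field exists and is unique up to isomorphism.) -/
def IsGFRepresentable {α : Type*} (M : Matroid α) (q : ℕ) : Prop :=
  ∃ (F : Type) (_ : Field F), Finite F ∧ Nat.card F = q ∧ M.IsRepresentableOver F

/-- The natural numbers `b` such that every finite simple cosimple `GF(q)`-representable
`(k, ℓ)`-uniform matroid has rank at most `b`. -/
def klRankBounds (k l q : ℕ) : Set ℕ :=
  {b : ℕ | ∀ (α : Type u) (M : Matroid α), M.Finite → M.IsSimple → M.IsCosimple →
    M.IsGFRepresentable q → M.IsKLUniform k l → M.eRank ≤ (b : ℕ∞)}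

end Matroid

/-!
Everything rests on one reformulation, `Matroid.not_isKLUniform_iff`: a finite matroid `M` fails to
be `(k, ℓ)`-uniform exactly when some set `X` has corank `r(M) - r(X)` at least `k` and nullity
`|X| - r(X)` at least `ℓ`.

**The recursion.** Let `M` be simple, cosimple and `(k + 1, ℓ)`-uniform of rank `r`. If `M` is also
`(k, ℓ + 1)`-uniform, its rank is at most `f(k, ℓ + 1, q)`. Otherwise some set has corank at least
`k` and nullity at least `ℓ + 1`, and it can be enlarged to a set `Y` of rank exactly `r - k`
without losing nullity. The restriction `M ↾ Y` is `(1, ℓ)`-uniform, since a subset of corank one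
in it has corank `k + 1` in `M`. It is cosimple, since deleting a coloop or a series pair would
leave a subset of corank one and nullity at least `ℓ`. Hence `r - k ≤ f(1, ℓ, q)`. See
`Matroid.exists_restrict_isCosimple`.

**Finiteness of `f`.** Write the columns of a representation of `M` in coordinates with respect to a
base `B`. When `r > k`, fix `k + 1` elements of `B`. Elements off `B` that agree in these
coordinates have rank at most one modulo the other `r - k - 1` base elements, so at most `ℓ` of them
can agree, and the dual `M✶` has rank at most `q ^ (k + 1) * ℓ`. Two elements of `B` whose coordinate
rows off `B` coincide would form a codependent pair, so cosimplicity bounds `r` by `q` to the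
power `r(M✶)`. See `Matroid.eRank_le_of_isKLUniform`.
-/

namespace Matroid

/-! ### Minors isomorphic to `U_{k,k} ⊕ U_{0,ℓ}` -/

lemma freeSumLoopy_ground (k l : ℕ) : (freeSumLoopy k l).E = univ := by
  ext x
  cases x <;> simp [freeSumLoopy]

lemma freeSumLoopy_indep_iff {k l : ℕ} {I : Set (Fin k ⊕ Fin l)} :
    (freeSumLoopy k l).Indep I ↔ ∀ j : Fin l, Sum.inr j ∉ I := by
  simp [freeSumLoopy, Set.eq_empty_iff_forall_notMem]

/-- An intrinsic description of the matroids isomorphic to `U_{k,k} ⊕ U_{0,ℓ}`. -/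
lemma isIsomorphic_freeSumLoopy_iff {α : Type*} {N : Matroid α} {k l : ℕ} :
    N.IsIsomorphic (freeSumLoopy k l) ↔ ∃ K L : Set α, Disjoint K L ∧ N.E = K ∪ L ∧
      K.encard = k ∧ L.encard = l ∧ ∀ I ⊆ N.E, (N.Indep I ↔ I ⊆ K) := by
  classical
  constructor
  · rintro ⟨e, he⟩
    let e' : N.E ≃ Fin k ⊕ Fin l :=
      e.trans ((Equiv.setCongr (freeSumLoopy_ground k l)).trans (Equiv.Set.univ _))
    have he' : ∀ x, e' x = (e x : Fin k ⊕ Fin l) := fun x ↦ rfl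
    have hinl : Function.Injective fun i : Fin k ↦ (e'.symm (.inl i) : α) := fun i j h ↦ by
      simpa [Subtype.coe_inj] using h
    have hinr : Function.Injective fun i : Fin l ↦ (e'.symm (.inr i) : α) := fun i j h ↦ by
      simpa [Subtype.coe_inj] using h
    refine ⟨range fun i : Fin k ↦ (e'.symm (.inl i) : α),
      range fun i : Fin l ↦ (e'.symm (.inr i) : α), ?_, ?_, ?_, ?_, ?_⟩
    · rw [Set.disjoint_left]
      rintro _ ⟨i, rfl⟩ ⟨j, h⟩
      simp [Subtype.coe_inj] at h
    · ext x
      constructor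
      · intro hx
        obtain ⟨y, hy⟩ := e'.symm.surjective ⟨x, hx⟩
        rcases y with i | j
        · exact .inl ⟨i, by simp [hy]⟩
        · exact .inr ⟨j, by simp [hy]⟩
      · rintro (⟨i, rfl⟩ | ⟨i, rfl⟩) <;> exact Subtype.coe_prop _
    · rw [← image_univ, hinl.injOn.encard_image]; simp
    · rw [← image_univ, hinr.injOn.encard_image]; simp
    · intro I hI
      have h := he ((↑) ⁻¹' I)
      rw [Subtype.image_preimage_coe, inter_eq_self_of_subset_right hI] at h
      rw [h, freeSumLoopy_indep_iff]
      constructor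
      · intro h x hx
        obtain ⟨y, hy⟩ := e'.symm.surjective ⟨x, hI hx⟩
        rcases y with i | j
        · exact ⟨i, by simp [hy]⟩
        · refine (h j ⟨e ⟨x, hI hx⟩, ⟨⟨x, hI hx⟩, hx, rfl⟩, ?_⟩).elim
          rw [← he', ← hy, Equiv.apply_symm_apply]
      · rintro h j ⟨_, ⟨x, hx, rfl⟩, hj⟩
        obtain ⟨i, hi⟩ := h hx
        rw [← he', ← Equiv.eq_symm_apply] at hj
        simp [hj, Subtype.coe_inj] at hi
  · rintro ⟨K, L, hdj, hE, hK, hL, hI⟩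
    have : Finite K := finite_of_encard_eq_coe hK
    have : Finite L := finite_of_encard_eq_coe hL
    have eK : K ≃ Fin k := Finite.equivFinOfCardEq (by
      rw [Nat.card_coe_set_eq, ncard_def, hK, ENat.toNat_natCast])
    have eL : L ≃ Fin l := Finite.equivFinOfCardEq (by
      rw [Nat.card_coe_set_eq, ncard_def, hL, ENat.toNat_natCast])
    let e := ((Equiv.setCongr hE).trans (Equiv.Set.union hdj)).trans (eK.sumCongr eL)
    refine ⟨e.trans ((Equiv.Set.univ _).symm.trans
      (Equiv.setCongr (freeSumLoopy_ground k l).symm)), fun I ↦ ?_⟩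
    rw [hI _ (by simp), freeSumLoopy_indep_iff]
    have hK' : ∀ x : N.E, (x : α) ∉ K ↔ ∃ j, e x = .inr j := by
      rintro ⟨x, hx⟩
      constructor
      · intro h
        exact ⟨eL ⟨x, (hE.subset hx).resolve_left h⟩, by
          simp [e, Equiv.Set.union_apply_right hdj (a := ⟨x, hE.subset hx⟩)
            ((hE.subset hx).resolve_left h)]⟩
      · rintro ⟨j, hj⟩ h
        simp [e, Equiv.Set.union_apply_left hdj (a := ⟨x, hE.subset hx⟩) h] at hj
    constructor
    · rintro h j ⟨_, ⟨x, hx, rfl⟩, hj⟩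
      exact (hK' x).2 ⟨j, hj⟩ (h ⟨x, hx, rfl⟩)
    · rintro h _ ⟨x, hx, rfl⟩
      by_contra hxK
      obtain ⟨j, hj⟩ := (hK' x).1 hxK
      exact h j ⟨_, ⟨x, hx, rfl⟩, hj⟩

/-- A finite matroid has a minor `U_{k,k} ⊕ U_{0,ℓ}` exactly when it has a set of corank at least
`k` and nullity at least `ℓ`: contract a basis of that set to get the loops. -/
lemma not_isKLUniform_iff {α : Type*} {M : Matroid α} [M.Finite] {k l : ℕ} :
    ¬ M.IsKLUniform k l ↔
      ∃ X ⊆ M.E, M.eRk X + k ≤ M.eRank ∧ M.eRk X + l ≤ X.encard := by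
  simp only [IsKLUniform, isIsomorphic_freeSumLoopy_iff, not_forall, not_not]
  constructor
  · rintro ⟨N, hN, K, L, hdj, hE, hKk, hLl, hI⟩
    obtain ⟨C, D, hC, hD, hCD, rfl⟩ := hN.exists_eq_contract_delete_disjoint
    simp only [delete_ground, contract_ground] at hE hI
    have hKE : K ⊆ M.E \ C := fun x hx ↦ (hE.symm.subset (.inl hx)).1
    have hLE : L ⊆ M.E \ C := fun x hx ↦ (hE.symm.subset (.inr hx)).1
    -- elements of `L` are loops of the minor, so they add nothing to the rank of `C`
    have hLC : L ⊆ M.closure C := by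
      intro x hx
      have hx' : x ∈ (M.E \ C) \ D := hE.symm.subset (.inr hx)
      have hl : (M ／ C ＼ D).IsLoop x := by
        rw [← singleton_dep, dep_iff, hI _ (by simpa using hx')]
        exact ⟨fun h ↦ hdj.notMem_of_mem_right hx (by simpa using h), by simpa using hx'⟩
      exact (contract_isLoop_iff_mem_closure.1 (delete_isLoop_iff.1 hl).1).1
    have hrk : M.eRk (C ∪ L) = M.eRk C := by
      rw [← M.eRk_closure_eq C]
      refine le_antisymm ?_ ?_
      · exact M.eRk_mono (union_subset (M.subset_closure C) hLC)
      · rw [eRk_closure_eq]; exact M.eRk_mono subset_union_left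
    obtain ⟨I, hIC⟩ := M.exists_isBasis C
    refine ⟨C ∪ L, union_subset hC (hLE.trans sdiff_subset), ?_, ?_⟩
    · have hKi : (M ／ C).Indep K :=
        Indep.of_delete ((hI K (hE.symm.subset.trans' subset_union_left)).2 subset_rfl)
      have hKI : M.Indep (K ∪ I) := (hIC.contract_indep_iff.1 hKi).1
      rw [hrk, ← hKk, ← hIC.encard_eq_eRk, add_comm, ← encard_union_eq]
      · exact hKI.encard_le_eRank
      · exact (disjoint_sdiff_left.mono_left hKE).mono_right hIC.subset
    · rw [hrk, ← hLl, encard_union_eq (disjoint_sdiff_right.mono_right hLE)]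
      gcongr
      exact M.eRk_le_encard C
  · rintro ⟨X, hX, hk, hl⟩
    obtain ⟨I, hI⟩ := M.exists_isBasis X
    obtain ⟨B, hB, hIB⟩ := hI.indep.exists_isBase_superset
    have hIfin : I.encard ≠ ⊤ := (M.set_finite I hI.indep.subset_ground).encard_lt_top.ne
    rw [← hB.encard_eq_eRank, ← hI.encard_eq_eRk, ← encard_sdiff_add_encard_of_subset hIB,
      add_comm, ENat.add_le_add_iff_right hIfin] at hk
    rw [← hI.encard_eq_eRk, ← encard_sdiff_add_encard_of_subset hI.subset,
      add_comm, ENat.add_le_add_iff_right hIfin] at hl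
    obtain ⟨K, hK, hKk⟩ := exists_subset_encard_eq hk
    obtain ⟨L, hL, hLl⟩ := exists_subset_encard_eq hl
    have hKL : ∀ x ∈ L, x ∉ B := fun x hx hxB ↦
      (hI.indep.mem_closure_iff_of_notMem (hL hx).2).1 (hI.subset_closure (hL hx).1) |>.not_indep
        (hB.indep.subset (insert_subset hxB hIB))
    have hdj : Disjoint K L := disjoint_left.2 fun x hxK hxL ↦ hKL x hxL (hK hxK).1
    have hsub : K ∪ L ⊆ (M ／ I).E := by
      rintro x (hx | hx)
      · exact ⟨hB.subset_ground (hK hx).1, (hK hx).2⟩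
      · exact ⟨hX (hL hx).1, (hL hx).2⟩
    refine ⟨(M ／ I) ↾ (K ∪ L), ?_, K, L, hdj, rfl, hKk, hLl, fun J hJ ↦ ?_⟩
    · rw [← delete_compl hsub]
      exact contract_delete_isMinor ..
    rw [restrict_indep_iff, and_iff_left (show J ⊆ K ∪ L from hJ), hI.indep.contract_indep_iff]
    constructor
    · rintro ⟨-, hJI⟩ x hx
      refine (hJ hx).resolve_right fun hxL ↦ ?_
      exact (hI.indep.mem_closure_iff_of_notMem (hL hxL).2).1 (hI.subset_closure (hL hxL).1)
        |>.not_indep (hJI.subset (insert_subset (.inl hx) subset_union_right))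
    · intro hJK
      exact ⟨disjoint_sdiff_left.mono_left (hJK.trans hK), hB.indep.subset
        (union_subset ((hJK.trans hK).trans sdiff_subset) hIB)⟩

/-! ### Restricting to a set of prescribed corank -/

/-- Nullity is monotone under inclusion. -/
lemma eRk_add_le_encard_of_subset {α : Type*} {M : Matroid α} {X Y : Set α} {n : ℕ∞}
    (hX : M.eRk X + n ≤ X.encard) (hXY : X ⊆ Y) : M.eRk Y + n ≤ Y.encard := by
  calc M.eRk Y + n ≤ M.eRk X + (Y \ X).encard + n := by
        gcongr
        simpa [union_eq_self_of_subset_left hXY] using M.eRk_union_le_eRk_add_encard X (Y \ X)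
    _ = (Y \ X).encard + (M.eRk X + n) := by ring
    _ ≤ (Y \ X).encard + X.encard := by gcongr
    _ = Y.encard := encard_sdiff_add_encard_of_subset hXY

lemma exists_superset_eRk_add_eq {α : Type*} {M : Matroid α} [M.Finite] {X : Set α} {k : ℕ}
    (hX : X ⊆ M.E) (hk : M.eRk X + k ≤ M.eRank) :
    ∃ Y ⊆ M.E, X ⊆ Y ∧ M.eRk Y + k = M.eRank := by
  obtain ⟨I, hI⟩ := M.exists_isBasis X
  obtain ⟨B, hB, hIB⟩ := hI.indep.exists_isBase_superset
  have hIfin : I.encard ≠ ⊤ := (M.set_finite I hI.indep.subset_ground).encard_lt_top.ne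
  rw [← hB.encard_eq_eRank, ← hI.encard_eq_eRk, ← encard_sdiff_add_encard_of_subset hIB,
    add_comm, ENat.add_le_add_iff_right hIfin] at hk
  obtain ⟨K, hK, hKk⟩ := exists_subset_encard_eq hk
  have hIK : I ⊆ B \ K := fun x hx ↦ ⟨hIB hx, fun h ↦ (hK h).2 hx⟩
  refine ⟨X ∪ B \ K, union_subset hX (sdiff_subset.trans hB.subset_ground), subset_union_left, ?_⟩
  rw [← hI.eRk_eq_eRk_union, union_eq_self_of_subset_left hIK,
    (hB.indep.subset sdiff_subset).eRk_eq_encard, ← hKk,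
    encard_sdiff_add_encard_of_subset (hK.trans sdiff_subset), hB.encard_eq_eRank]

lemma IsSimple.restrict {α : Type*} {M : Matroid α} (hM : M.IsSimple) {Y : Set α} (hY : Y ⊆ M.E) :
    (M ↾ Y).IsSimple := by
  rw [← delete_compl hY]
  exact ⟨fun e he ↦ hM.1 e (delete_isLoop_iff.1 he).1, fun e f hef h ↦ hM.2 e f hef h.of_delete⟩

lemma IsGFRepresentable.restrict {α : Type*} {M : Matroid α} {q : ℕ} (hM : M.IsGFRepresentable q)
    {Y : Set α} (hY : Y ⊆ M.E) : (M ↾ Y).IsGFRepresentable q := by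
  obtain ⟨F, hF, hfin, hq, m, A, hA⟩ := hM
  refine ⟨F, hF, hfin, hq, m, A, fun I (hI : I ⊆ Y) ↦ ?_⟩
  rw [restrict_indep_iff, and_iff_left hI, hA I (hI.trans hY)]

/-- A matroid is cosimple once no set of at most two elements is dependent in the dual. -/
lemma isCosimple_of_forall_coindep {α : Type*} {M : Matroid α}
    (h : ∀ D ⊆ M.E, D.encard ≤ 2 → M.Coindep D) : M.IsCosimple := by
  refine ⟨fun e he ↦ ?_, fun e f _ hef ↦ ?_⟩
  · exact (singleton_dep.2 he).not_indep
      (h {e} (singleton_subset_iff.2 he.mem_ground) (by simp)).indep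
  · exact hef.dep.not_indep (h {e, f} hef.subset_ground (by
      grw [encard_insert_le, encard_singleton]; rfl)).indep

lemma IsCosimple.coindep_pair {α : Type*} {M : Matroid α} (hM : M.IsCosimple) {e f : α}
    (he : e ∈ M.E) (hf : f ∈ M.E) (hef : e ≠ f) : M.Coindep {e, f} := by
  by_contra h
  have hD : M✶.Dep {e, f} := ⟨h, pair_subset he hf⟩
  obtain ⟨C, hC, hCc⟩ := hD.exists_isCircuit_subset
  rcases subset_pair_iff_eq.1 hC with rfl | rfl | rfl | rfl
  · simpa using hCc.nonempty
  · exact hM.1 _ (singleton_isCircuit.1 hCc)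
  · exact hM.1 _ (singleton_isCircuit.1 hCc)
  · exact hM.2 e f hef hCc

/-- If `M` is `(k + 1, ℓ)`-uniform but not `(k, ℓ + 1)`-uniform, then a set `Y` of corank exactly
`k` and nullity at least `ℓ + 1` gives a `(1, ℓ)`-uniform cosimple restriction. A coloop or series
pair of `M ↾ Y` cannot exist: deleting it would leave a set of corank at least `k + 1` whose
nullity dropped by at most one. -/
lemma exists_restrict_isCosimple {α : Type*} {M : Matroid α} [M.Finite] {k l : ℕ}
    (hM : M.IsKLUniform (k + 1) l) (hM' : ¬ M.IsKLUniform k (l + 1)) :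
    ∃ Y ⊆ M.E, (M ↾ Y).eRank + k = M.eRank ∧ (M ↾ Y).IsCosimple ∧ (M ↾ Y).IsKLUniform 1 l := by
  obtain ⟨X, hX, hXk, hXl⟩ := not_isKLUniform_iff.1 hM'
  obtain ⟨Y, hY, hXY, hYk⟩ := exists_superset_eRk_add_eq hX hXk
  have hYl := eRk_add_le_encard_of_subset hXl hXY
  -- a set of corank at least one in `M ↾ Y` has corank at least `k + 1` in `M`
  have key : ∀ Z ⊆ Y, M.eRk Z + 1 ≤ M.eRk Y → ¬ M.eRk Z + l ≤ Z.encard := by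
    intro Z hZ h1 hl
    refine not_isKLUniform_iff.2 ⟨Z, hZ.trans hY, ?_, hl⟩ hM
    calc M.eRk Z + (k + 1 : ℕ) = M.eRk Z + 1 + k := by push_cast; ring
      _ ≤ M.eRk Y + k := by gcongr
      _ = M.eRank := hYk
  have : (M ↾ Y).Finite := ⟨M.set_finite Y hY⟩
  refine ⟨Y, hY, by rwa [eRank_restrict], isCosimple_of_forall_coindep fun D hD hD2 ↦ ?_, ?_⟩
  · replace hD : D ⊆ Y := hD
    by_contra hco
    have hlt : M.eRk (Y \ D) < M.eRk Y := by
      refine (M.eRk_mono sdiff_subset).lt_of_ne fun heq ↦ hco ?_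
      obtain ⟨B, hB⟩ := M.exists_isBasis (Y \ D) (sdiff_subset.trans hY)
      refine (coindep_iff_exists (M := M ↾ Y) hD).2 ⟨B, ?_, hB.subset⟩
      rw [isBase_restrict_iff hY]
      exact hB.indep.isBasis_of_eRk_ge (M.set_finite B hB.indep.subset_ground)
        (hB.subset.trans sdiff_subset) (by rw [← heq, hB.eRk_eq_eRk]) hY
    refine key (Y \ D) sdiff_subset (Order.add_one_le_of_lt hlt) ?_
    have hDfin : D.encard ≠ ⊤ := ne_top_of_le_ne_top (by simp) hD2
    rw [← ENat.add_le_add_iff_right hDfin, encard_sdiff_add_encard_of_subset hD]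
    calc M.eRk (Y \ D) + l + D.encard ≤ M.eRk (Y \ D) + l + 2 := by gcongr
      _ = M.eRk (Y \ D) + 1 + (l + 1 : ℕ) := by push_cast; ring
      _ ≤ M.eRk Y + (l + 1 : ℕ) := by gcongr; exact Order.add_one_le_of_lt hlt
      _ ≤ Y.encard := hYl
  · by_contra h
    obtain ⟨Z, hZ, hZ1, hZl⟩ := not_isKLUniform_iff.1 h
    replace hZ : Z ⊆ Y := hZ
    rw [eRank_restrict, restrict_eRk_eq _ hZ] at hZ1
    rw [restrict_eRk_eq _ hZ] at hZl
    exact key Z hZ (by exact_mod_cast hZ1) hZl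

/-! ### Bounding the rank from a representation -/

section Representation

variable {α F : Type*} [Field F] {M : Matroid α} {m : ℕ} {A : Matrix (Fin m) α F}

/-- A finite set of vectors spanning the columns of `X` bounds the rank of `X`. -/
lemma eRk_le_encard_of_col_mem_span
    (hA : ∀ I : Set α, I ⊆ M.E → (M.Indep I ↔ LinearIndepOn F (fun j => A.col j) I))
    {X : Set α} {W : Set (Fin m → F)} (hW : W.Finite)
    (hX : ∀ x ∈ X ∩ M.E, A.col x ∈ Submodule.span F W) : M.eRk X ≤ W.encard := by
  rw [eRk_le_iff]
  intro I hIX hI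
  have := hW.fintype
  have h := linearIndependent_le_span' _ ((hA I hI.subset_ground).1 hI) W (by
    rintro _ ⟨x, rfl⟩
    exact hX x ⟨hIX x.2, hI.subset_ground x.2⟩)
  rw [encard, ENat.card, ← Set.coe_fintypeCard]
  simpa using Cardinal.toENat_le_natCast.2 h

lemma IsBase.exists_col_eq_sum
    (hA : ∀ I : Set α, I ⊆ M.E → (M.Indep I ↔ LinearIndepOn F (fun j => A.col j) I))
    {B : Finset α} (hB : M.IsBase B) :
    ∃ c : α → α → F, ∀ e ∈ M.E, A.col e = ∑ b ∈ B, c e b • A.col b := by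
  have h : ∀ e ∈ M.E, ∃ c : α → F, A.col e = ∑ b ∈ B, c b • A.col b := by
    intro e he
    have hmem : A.col e ∈ Submodule.span F ((fun j ↦ A.col j) '' (B : Set α)) := by
      refine (LinearIndepOn.mem_span_iff ((hA _ hB.subset_ground).1 hB.indep)).2 fun h ↦ ?_
      by_contra heB
      exact heB (hB.mem_of_insert_indep ((hA _ (insert_subset he hB.subset_ground)).2 h))
    obtain ⟨c, hc⟩ := Submodule.mem_span_image_finset_iff_exists_fun' F |>.1 hmem
    exact ⟨c, hc.symm⟩
  choose! c hc using h
  exact ⟨c, hc⟩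

variable {B : Finset α} {c : α → α → F}

/-- In a cosimple matroid, two base elements whose coordinates agree off the base would be in
series: with both deleted, the columns lie in the span of `|B| - 1` vectors. -/
lemma IsCosimple.exists_coord_ne (hM : M.IsCosimple)
    (hA : ∀ I : Set α, I ⊆ M.E → (M.Indep I ↔ LinearIndepOn F (fun j => A.col j) I))
    (hB : M.IsBase B) (hc : ∀ e ∈ M.E, A.col e = ∑ b ∈ B, c e b • A.col b) {b b' : α}
    (hb : b ∈ B) (hb' : b' ∈ B) (hbb' : b ≠ b') : ∃ e ∈ M.E \ B, c e b ≠ c e b' := by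
  classical
  by_contra! hcon
  obtain ⟨B', hB', hB'E⟩ := (hM.coindep_pair (hB.subset_ground hb) (hB.subset_ground hb')
    hbb').exists_isBase_subset_compl
  set C := (B.erase b).erase b' with hC
  have hCcard : C.card + 2 = B.card := by
    have hb'e : b' ∈ B.erase b := Finset.mem_erase.2 ⟨hbb'.symm, hb'⟩
    have h1 := Finset.card_erase_add_one hb'e
    have h2 := Finset.card_erase_add_one hb
    rw [hC]
    omega
  let W : Finset (Fin m → F) := insert (A.col b + A.col b') (C.image fun j ↦ A.col j)
  have hle : M.eRk B' ≤ (W : Set (Fin m → F)).encard := by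
    refine eRk_le_encard_of_col_mem_span hA W.finite_toSet ?_
    rintro x ⟨hx, hxE⟩
    have hcol : ∀ j ∈ C, A.col j ∈ Submodule.span F (W : Set (Fin m → F)) := fun j hj ↦
      Submodule.subset_span (Finset.mem_coe.2
        (Finset.mem_insert_of_mem (Finset.mem_image_of_mem _ hj)))
    have hx' := (hB'E hx).2
    simp only [mem_insert_iff, mem_singleton_iff, not_or] at hx'
    by_cases hxB : x ∈ B
    · exact hcol x (Finset.mem_erase.2 ⟨hx'.2, Finset.mem_erase.2 ⟨hx'.1, hxB⟩⟩)
    -- off the base, `b` and `b'` occur in `x` with the same coefficient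
    · have hs : A.col x = c x b • (A.col b + A.col b') + ∑ j ∈ C, c x j • A.col j := by
        rw [hc x hxE, ← Finset.add_sum_erase B _ hb,
          ← Finset.add_sum_erase (B.erase b) _ (Finset.mem_erase.2 ⟨hbb'.symm, hb'⟩),
          hcon x ⟨hxE, hxB⟩, smul_add, add_assoc]
      rw [hs]
      exact add_mem (Submodule.smul_mem _ _ (Submodule.subset_span (by simp [W])))
        (sum_mem fun j hj ↦ Submodule.smul_mem _ _ (hcol j hj))
  rw [hB'.indep.eRk_eq_encard, hB'.encard_eq_encard_of_isBase hB, encard_coe_eq_coe_finsetCard,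
    encard_coe_eq_coe_finsetCard, Nat.cast_le] at hle
  have hWcard : W.card ≤ C.card + 1 :=
    (Finset.card_insert_le _ _).trans (Nat.add_le_add_right Finset.card_image_le 1)
  omega

/-- Elements outside the base `B` with equal coordinates on `K ⊆ B` form, with `B \ K`, a set of
rank at most `|B| - |K| + 1`; so `(k, ℓ)`-uniformity allows at most `ℓ` of them
when `|K| = k + 1`. -/
lemma IsKLUniform.card_le_of_coord_eq [M.Finite] {k l : ℕ} (hM : M.IsKLUniform k l)
    (hA : ∀ I : Set α, I ⊆ M.E → (M.Indep I ↔ LinearIndepOn F (fun j => A.col j) I))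
    (hB : M.IsBase B) (hc : ∀ e ∈ M.E, A.col e = ∑ b ∈ B, c e b • A.col b)
    {K S : Finset α} (hK : K ⊆ B) (hKk : K.card = k + 1) (hS : (S : Set α) ⊆ M.E \ B)
    {v : α → F} (hv : ∀ e ∈ S, ∀ b ∈ K, c e b = v b) : S.card ≤ l := by
  classical
  by_contra! hlt
  let W : Finset (Fin m → F) :=
    insert (∑ b ∈ K, v b • A.col b) ((B \ K).image fun j ↦ A.col j)
  have hrk : M.eRk ((B \ K : Finset α) ∪ S : Set α) ≤ (W : Set (Fin m → F)).encard := by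
    refine eRk_le_encard_of_col_mem_span hA W.finite_toSet ?_
    have hcol : ∀ j ∈ B \ K, A.col j ∈ Submodule.span F (W : Set (Fin m → F)) := fun j hj ↦
      Submodule.subset_span (Finset.mem_coe.2
        (Finset.mem_insert_of_mem (Finset.mem_image_of_mem _ hj)))
    rintro x ⟨hx | hx, hxE⟩
    · exact hcol x hx
    · rw [hc x hxE, ← Finset.sum_sdiff hK, Finset.sum_congr rfl
        (fun b hb ↦ by rw [hv x hx b hb] : ∀ b ∈ K, c x b • A.col b = v b • A.col b)]
      exact add_mem (sum_mem fun j hj ↦ Submodule.smul_mem _ _ (hcol j hj))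
        (Submodule.subset_span (by simp [W]))
  have hWcard : W.card ≤ (B \ K).card + 1 :=
    (Finset.card_insert_le _ _).trans (Nat.add_le_add_right Finset.card_image_le 1)
  have hBK := Finset.card_sdiff_add_card_eq_card hK
  rw [encard_coe_eq_coe_finsetCard] at hrk
  refine not_isKLUniform_iff.2 ⟨(B \ K : Finset α) ∪ S, union_subset ?_ ?_, ?_, ?_⟩ hM
  · exact (Finset.coe_subset.2 Finset.sdiff_subset).trans hB.subset_ground
  · exact hS.trans sdiff_subset
  · rw [← hB.encard_eq_eRank, encard_coe_eq_coe_finsetCard]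
    grw [hrk]
    norm_cast
    omega
  · have hdj : Disjoint ((B \ K : Finset α) : Set α) S := disjoint_left.2 fun x hx hxS ↦
      (hS hxS).2 (Finset.mem_sdiff.1 hx).1
    rw [encard_union_eq hdj, encard_coe_eq_coe_finsetCard, encard_coe_eq_coe_finsetCard]
    grw [hrk]
    norm_cast
    omega

/-- The rank bound: with `n` elements and rank `r > k`, the coordinates on `k + 1` base elements
take at most `q ^ (k + 1)` values, each at most `ℓ` times off the base, which bounds the dual
rank `n - r`; cosimplicity makes the `r` coordinate rows off the base distinct, so
`r ≤ q ^ (n - r)`. -/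
lemma eRank_le_of_isKLUniform [M.Finite] [Finite F] {k l : ℕ} (hM : M.IsKLUniform k l)
    (hco : M.IsCosimple)
    (hA : ∀ I : Set α, I ⊆ M.E → (M.Indep I ↔ LinearIndepOn F (fun j => A.col j) I)) :
    M.eRank ≤ (max k (Nat.card F ^ (Nat.card F ^ (k + 1) * l)) : ℕ) := by
  classical
  have := Fintype.ofFinite F
  obtain ⟨B', hB'⟩ := M.exists_isBase
  obtain ⟨B, rfl⟩ := (M.set_finite B' hB'.subset_ground).exists_finset_coe
  obtain ⟨D, hD⟩ := (M.set_finite (M.E \ B) sdiff_subset).exists_finset_coe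
  obtain ⟨c, hc⟩ := hB'.exists_col_eq_sum hA
  rw [← hB'.encard_eq_eRank, encard_coe_eq_coe_finsetCard, Nat.cast_le, le_max_iff,
    or_iff_not_imp_left, not_le, Nat.card_eq_fintype_card]
  intro hk
  obtain ⟨K, hK, hKk⟩ := Finset.exists_subset_card_eq (Nat.succ_le_of_lt hk)
  -- pigeonhole on the coordinates indexed by `K`
  have hDcard : D.card ≤ Fintype.card F ^ (k + 1) * l := by
    have h := Finset.card_le_mul_card_image (s := D)
      (f := fun e (b : K) ↦ c e b) l fun v hv ↦ by
        obtain ⟨e, he, rfl⟩ := Finset.mem_image.1 hv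
        refine hM.card_le_of_coord_eq hA hB' hc hK hKk (v := c e) ?_ ?_
        · rw [← hD]; exact Finset.coe_subset.2 (Finset.filter_subset _ _)
        · intro e' he' b hb
          exact congrFun (Finset.mem_filter.1 he').2 ⟨b, hb⟩
    have h2 := Finset.card_le_univ (D.image fun e (b : K) ↦ c e b)
    rw [Fintype.card_fun, Fintype.card_coe, hKk] at h2
    calc D.card ≤ _ := h
      _ ≤ _ := by rw [mul_comm]; gcongr
  -- the coordinate rows off the base are distinct
  have hinj : Function.Injective fun (b : B) (e : D) ↦ c e b := by
    intro b b' h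
    by_contra hne
    obtain ⟨e, he, hne'⟩ := hco.exists_coord_ne hA hB' hc b.2 b'.2
      (fun h ↦ hne (Subtype.ext h))
    exact hne' (congrFun h ⟨e, by rw [← Finset.mem_coe, hD]; exact he⟩)
  have h := Fintype.card_le_of_injective _ hinj
  rw [Fintype.card_coe, Fintype.card_fun, Fintype.card_coe] at h
  exact h.trans (Nat.pow_le_pow_right Fintype.card_pos hDcard)

end Representation

/-! ### The least rank bounds -/

lemma klRankBounds_nonempty (k l q : ℕ) : (klRankBounds.{u} k l q).Nonempty := by
  refine ⟨max k (q ^ (q ^ (k + 1) * l)), ?_⟩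
  rintro α M hfin - hco ⟨F, _, _, rfl, m, A, hA⟩ hM
  exact eRank_le_of_isKLUniform hM hco hA

lemma mem_klRankBounds_succ {k l q a b : ℕ} (ha : a ∈ klRankBounds.{u} k (l + 1) q)
    (hb : b ∈ klRankBounds.{u} 1 l q) : max a (b + k) ∈ klRankBounds.{u} (k + 1) l q := by
  intro α M hfin hs hco hF hM
  by_cases hM' : M.IsKLUniform k (l + 1)
  · exact (ha α M hfin hs hco hF hM').trans (by simp)
  · obtain ⟨Y, hY, hYk, hYco, hYu⟩ := exists_restrict_isCosimple hM hM'
    have h := hb α (M ↾ Y) ⟨M.set_finite Y hY⟩ (hs.restrict hY) hYco (hF.restrict hY) hYu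
    rw [← hYk]
    grw [h]
    exact_mod_cast le_max_right a (b + k)

end Matroid

theorem mainTheorem3 :
    ∃ f : ℕ → ℕ → ℕ → ℕ,
      (∀ k l q : ℕ, 1 ≤ k → 1 ≤ l → IsPrimePow q →
        IsLeast (Matroid.klRankBounds.{u} k l q) (f k l q)) ∧
      (∀ k l q : ℕ, 2 ≤ k → 1 ≤ l → IsPrimePow q →
        f k l q ≤ max (f (k - 1) (l + 1) q) (f 1 l q + (k - 1))) := by
  have hleast : ∀ k l q, IsLeast (Matroid.klRankBounds.{u} k l q)
      (sInf (Matroid.klRankBounds.{u} k l q)) := fun k l q ↦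
    ⟨Nat.sInf_mem (Matroid.klRankBounds_nonempty k l q), fun _ ↦ Nat.sInf_le⟩
  refine ⟨fun k l q ↦ sInf (Matroid.klRankBounds.{u} k l q), fun k l q _ _ _ ↦ hleast k l q,
    fun k l q hk _ _ ↦ ?_⟩
  obtain ⟨k, rfl⟩ := Nat.exists_eq_add_of_le' (one_le_two.trans hk)
  exact (hleast (k + 1) l q).2
    (Matroid.mem_klRankBounds_succ (hleast k (l + 1) q).1 (hleast 1 l q).1)
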